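/- **Corollary 5.1 (Adaptive case).** *Model.* Let $\Theta\subset\mathbb R^k$ be open, $\mathcal G$ a subset of a real Hilbert space $\mathcal H$, and $\mathcal P=\{P_{\theta,G}:\theta\in\Theta,\ G\in\mathcal G\}$ a family of probability measures on a measurable space $(\mathcal X,\mathcal A)$. Let $\mathcal B$ be a Banach space with dual $\mathcal B^*$, $\mathcal B_0^*\subset\mathcal B^*$, and let $\nu(P_{\theta,G})=\tilde\nu(G)$ with $\tilde\nu:\mathcal G\to\mathcal B$. Fix $\theta_0\in\Theta$ and $G\in\mathcal G$. Let $\mathcal C_G$ be a collection of paths $\{G_\eta:-1<\eta<1\}\subset\mathcal G$ with $G_0=G$, each of them either continuously Fréchet differentiable with nonvanishing derivative or the constant path, and containing the constant path. The tangent of a path is its derivative $\dot G$ at $\eta=0$; $\dot{\mathcal G}$ is the closed linear span of the tangents. For a one-dimensional family $Q_\eta$ of probability measures with $Q_0=P$, a function $\rho\in L_2^0(P)$ (square integrable, mean zero) is called the tangent of the family if, for a dominating $\sigma$-finite measure $\mu$ (for $\eta$ near $0$) and $s_\eta=(dQ_\eta/d\mu)^{1/2}$, $s_\eta=s_0+\tfrac12\eta\rho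 s_0+o(\eta)$ in $L_2(\mu)$. Let $\dot{\mathcal P}$ be the closed linear span in $L_2^0(P_{\theta_0,G})$ of all tangents of the families $\eta\mapsto P_{\theta_0+\eta\zeta,G_\eta}$ with $\zeta\in\mathbb R^k$ and $\{G_\eta\}\in\mathcal C_G$, and let $\dot{\mathcal P}_2$ be the closed linear span of the tangents of the families $\eta\mapsto P_{\theta_0,G_\eta}$. *Assumptions on the model.* 1. $\{P_{\theta,G}:\theta\in\Theta\}$ is a regular parametric model: it is dominated by a $\sigma$-finite $\mu$; for every $\theta\in\Theta$ there is a vector $\dot l(\theta)$ of score functions in $L_2(P_{\theta,G})$ with $s(\tilde\theta)=s(\theta)+\tfrac12(\tilde\theta-\theta)^\top\dot l(\theta)s(\theta)+o(|\tilde\theta-\theta|)$ in $L_2(\mu)$, where $s(\theta)=(dP_{\theta,G}/d\mu)^{1/2}$; its Fisher information matrix is nonsingular at every $\theta\in\Theta$; and $\theta\mapsto\dot l(\theta)s(\theta)$ is continuous from $\Theta$ into $L_2(\mu)^k$. 2. The model is Hellinger differentiable at $P_{\theta,G}$ for every $\theta\in\Theta$: there is a bounded linear $\dot l(\theta):\mathbb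 R^k\times\dot{\mathcal G}\to L_2^0(P_{\theta,G})$ such that $\dot l(\theta)(\zeta,\dot G)$ is the tangent of $\eta\mapsto P_{\theta+\eta\zeta,G_\eta}$ for every $\zeta\in\mathbb R^k$ and every path in $\mathcal C_G$ with tangent $\dot G$. Write $\dot l(\theta)(\zeta,h)=\dot l_1(\theta)^\top\zeta+\dot l_2(\theta)h$, and let $\dot l_2^\top$ be the adjoint of $\dot l_2$. 3. The set of tangents of the paths in $\mathcal C_G$ is a closed linear subspace of $\mathcal H$. 4. $\tilde\nu$ is pathwise differentiable at $G$: there is a bounded linear $\dot{\tilde\nu}:\dot{\mathcal G}\to\mathcal B$ with $\|\tilde\nu(G_\eta)-\tilde\nu(G)-\eta\dot{\tilde\nu}(\dot G)\|=o(\eta)$ for every path in $\mathcal C_G$. For $b^*\in\mathcal B^*$ let $\dot{\tilde\nu}_{b^*}\in\dot{\mathcal G}$ be the Riesz representer of $b^*\circ\dot{\tilde\nu}$. 5. The efficient information matrix $I_*(\theta_0)=E_{\theta_0,G}(l_1^*l_1^{*\top})$ is nonsingular, where $l_1^*=\dot l_1(\theta_0)-\Pi(\dot l_1(\theta_0)\mid\dot{\mathcal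 P}_2)$ and $\Pi$ is the orthogonal projection. 6. $\dot{\tilde\nu}_{b^*}$ is in the range of $\dot l_2^\top(\theta_0)\dot l_2(\theta_0)$ for every $b^*\in\mathcal B^*$; and for each $b^*\in\mathcal B_0^*$ the function $$\psi(\cdot;\theta,G;b^*)=\dot l_2(\theta)h,\qquad h\in\dot{\mathcal G},\quad \dot l_2^\top(\theta)\dot l_2(\theta)h=\dot{\tilde\nu}_{b^*},$$ exists for all $\theta$ in a neighbourhood of $\theta_0$ (fix any version of it). 7. Orthogonality: every component of $\dot l_1(\theta_0)$ is orthogonal to $\dot{\mathcal P}_2$ in $L_2(P_{\theta_0,G})$. Below, $X_1,X_2,\dots$ are i.i.d. with law $P_{\theta_0,G}$, and a *local sequence* is a sequence $\{\theta_n\}\subset\Theta$ with $\{\sqrt n(\theta_n-\theta_0)\}$ bounded. 8. For every local sequence and every $b^*\in\mathcal B^*_0$, $$\frac1{\sqrt n}\sum_{i=1}^n\psi(X_i;\theta_n,G;b^*)-\frac1{\sqrt n}\sum_{i=1}^n\psi(X_i;\theta_0,G;b^*)\to0\quad\text{in }P_{\theta_0,G}\text{-probability}.$$ *Assumptions on the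 estimators.* $\hat\nu_{\theta,n}=u_n(X_1,\dots,X_n;\theta)\in\mathcal B$ (defined for all $\theta\in\mathbb R^k$, arbitrarily outside $\Theta$) with $b^*\circ u_n$ jointly measurable for $b^*\in\mathcal B_0^*$, and it is $\mathcal B_0^*$-weakly locally submodel efficient: for every local sequence and every $b^*\in\mathcal B^*_0$, $$\sqrt n\Big|b^*(\hat\nu_{\theta_n,n}-\tilde\nu(G))-\frac1n\sum_{i=1}^n\psi(X_i;\theta_n,G;b^*)\Big|\to0\quad\text{in }P_{\theta_0,G}\text{-probability}.$$ $\hat\theta_n=t_n(X_1,\dots,X_n)\in\mathbb R^k$ is measurable and $\sqrt n$-consistent at $\theta_0$: $\sqrt n(\hat\theta_n-\theta_0)$ is bounded in $P_{\theta_0,G}$-probability. The integers $0\le\lambda_n\le n$ satisfy $0<\liminf\lambda_n/n\le\limsup\lambda_n/n<1$. With $\tilde\theta_{n1}=t_{\lambda_n}(X_1,\dots,X_{\lambda_n})$ and $\tilde\theta_{n2}=t_{n-\lambda_n}(X_{\lambda_n+1},\dots,X_n)$, put $$\hat\nu_n=\frac{\lambda_n}n\,u_{\lambda_n}(X_1,\dots,X_{\lambda_n};\tilde\theta_{n2})+\frac{n-\lambda_n}n\,u_{n-\lambda_n}(X_{\lambda_n+1},\dots,X_n;\tilde\theta_{n1}).$$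 *Conclusion.* $\hat\nu_n$ is a $\mathcal B_0^*$-weakly efficient estimator of $\nu$ within the full model $\mathcal P$ at $P_{\theta_0,G}$, with influence function $\psi$; that is: (a) $\nu$ is pathwise differentiable at $P_{\theta_0,G}$ in the full model: there is a bounded linear $\dot\nu:\dot{\mathcal P}\to\mathcal B$ with $\|\tilde\nu(G_\eta)-\tilde\nu(G)-\eta\dot\nu(\rho)\|=o(\eta)$ for all $\zeta\in\mathbb R^k$ and $\{G_\eta\}\in\mathcal C_G$ such that $\eta\mapsto P_{\theta_0+\eta\zeta,G_\eta}$ has tangent $\rho$; and for $b^*\in\mathcal B_0^*$ its efficient influence function, the Riesz representer of $b^*\circ\dot\nu$ in $\dot{\mathcal P}$, equals $\psi(\cdot;\theta_0,G;b^*)$ $P_{\theta_0,G}$-almost surely; (b) for every local sequence $\{\theta_n\}$ and every $b^*\in\mathcal B_0^*$, $$\sqrt n\Big|b^*(\hat\nu_n-\nu(P_{\theta_n,G}))-\frac1n\sum_{i=1}^n\psi(X_i;\theta_n,G;b^*)\Big|\to0\quad\text{in }P_{\theta_0,G}\text{-probability}.$$ -/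

import Mathlib

open Filter Topology MeasureTheory Asymptotics

noncomputable section

namespace AdaptiveSplit

variable {𝒳 : Type*} [MeasurableSpace 𝒳]
variable {H : Type*} [NormedAddCommGroup H] [InnerProductSpace ℝ H] [CompleteSpace H]
variable {B : Type*} [NormedAddCommGroup B] [NormedSpace ℝ B]
variable {k : ℕ}

/-- The Euclidean space `ℝᵏ` that contains the parameter set `Θ`. -/
abbrev Eucl (k : ℕ) := EuclideanSpace ℝ (Fin k)

/-! ### Root densities, tangents, regular parametric models -/

/-- The root density `s = (dQ/dμ)^{1/2}`. -/
def rootDensity (μ : Measure 𝒳) (Q : ProbabilityMeasure 𝒳) (x : 𝒳) : ℝ :=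
  Real.sqrt (((Q : Measure 𝒳).rnDeriv μ x).toReal)

/-- `ρ ∈ L₂⁰(P₀)` is the tangent at `η = 0` of the one-dimensional family `Q_η` through `P₀`:
for some σ-finite `μ` dominating the family (for `η` near `0`),
`s_η = s_0 + (η/2) ρ s_0 + o(η)` in `L₂(μ)`. -/
def IsTangent (P₀ : ProbabilityMeasure 𝒳) (Q : ℝ → ProbabilityMeasure 𝒳)
    (ρ : Lp ℝ 2 (P₀ : Measure 𝒳)) : Prop :=
  (∫ x, ρ x ∂(P₀ : Measure 𝒳)) = 0 ∧
  ∃ μ : Measure 𝒳, SigmaFinite μ ∧ (P₀ : Measure 𝒳) ≪ μ ∧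
    (∀ᶠ η in 𝓝 (0 : ℝ), (Q η : Measure 𝒳) ≪ μ) ∧
    (fun η : ℝ => (eLpNorm (fun x => rootDensity μ (Q η) x - rootDensity μ P₀ x
        - (1 / 2) * η * ρ x * rootDensity μ P₀ x) 2 μ).toReal) =o[𝓝 0] (fun η : ℝ => η)

/-- The family `{Q θ : θ ∈ Θ}` is a `k`-dimensional regular parametric model (`Θ` open):
it is dominated, root densities are Fréchet differentiable in `L₂(μ)` with score functions in
`L₂(Q θ)`, the Fisher information matrix is nonsingular, and `θ ↦ score(θ) s(θ)` is continuous
into `L₂(μ)ᵏ`. -/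
def IsRegularParametricModel (Θ : Set (Eucl k)) (Q : Eucl k → ProbabilityMeasure 𝒳) : Prop :=
  IsOpen Θ ∧
  ∃ μ : Measure 𝒳, SigmaFinite μ ∧ (∀ θ ∈ Θ, (Q θ : Measure 𝒳) ≪ μ) ∧
  ∃ score : Fin k → Eucl k → 𝒳 → ℝ,
    (∀ j, ∀ θ ∈ Θ, MemLp (score j θ) 2 (Q θ : Measure 𝒳)) ∧
    (∀ θ ∈ Θ,
      (fun θ' : Eucl k => (eLpNorm (fun x => rootDensity μ (Q θ') x - rootDensity μ (Q θ) x
        - (1 / 2) * (∑ j, (θ' j - θ j) * score j θ x) * rootDensity μ (Q θ) x) 2 μ).toReal)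
        =o[𝓝 θ] (fun θ' : Eucl k => θ' - θ)) ∧
    (∀ θ ∈ Θ, IsUnit (Matrix.of fun i j : Fin k =>
        ∫ x, score i θ x * score j θ x ∂(Q θ : Measure 𝒳)).det) ∧
    (∀ j, ∀ θ ∈ Θ, Tendsto (fun θ' : Eucl k =>
        eLpNorm (fun x => score j θ' x * rootDensity μ (Q θ') x
          - score j θ x * rootDensity μ (Q θ) x) 2 μ) (𝓝[Θ] θ) (𝓝 0))

/-! ### Paths in the Hilbert space and their tangent space -/

/-- `c` is a path `{c η : -1 < η < 1}` in `𝒢` through `G`: continuously differentiable with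
nonvanishing derivative. The constant path is admitted as well; it has tangent `0`. -/
def IsPath (𝒢 : Set H) (G : H) (c : ℝ → H) : Prop :=
  (∀ η ∈ Set.Ioo (-1 : ℝ) 1, c η ∈ 𝒢) ∧ c 0 = G ∧ ContDiffOn ℝ 1 c (Set.Ioo (-1) 1) ∧
    ((∀ η ∈ Set.Ioo (-1 : ℝ) 1, deriv c η ≠ 0) ∨ c = fun _ => G)

/-- A collection of paths in `𝒢` through `G`; the constant path belongs to it. -/
def IsPathCollection (𝒢 : Set H) (G : H) (𝒞 : Set (ℝ → H)) : Prop :=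
  (∀ c ∈ 𝒞, IsPath 𝒢 G c) ∧ (fun _ => G) ∈ 𝒞

/-- The set of tangents `Ġ⁰` of the paths in `𝒞`. -/
def tangentSet (𝒞 : Set (ℝ → H)) : Set H := (fun c => deriv c 0) '' 𝒞

/-- The tangent space `Ġ`, the closed linear span of the tangents. -/
abbrev tangentSpace (𝒞 : Set (ℝ → H)) : Submodule ℝ H :=
  (Submodule.span ℝ (tangentSet 𝒞)).topologicalClosure

/-- `D : Ġ → B` is the pathwise derivative of `ν` at `G`:
`‖ν(G_η) - ν(G) - η D(Ġ)‖ = o(η)` along every path in `𝒞`. -/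
def IsPathwiseDeriv (𝒞 : Set (ℝ → H)) (G : H) (ν : H → B) (D : tangentSpace 𝒞 →L[ℝ] B) : Prop :=
  ∀ c ∈ 𝒞, ∀ h : tangentSpace 𝒞, (h : H) = deriv c 0 →
    (fun η : ℝ => ν (c η) - ν G - η • D h) =o[𝓝 0] (fun η : ℝ => η)

/-- For a bounded linear `D : V → B` on a Hilbert space `V` and `b ∈ B*`, the Riesz representer of
`b ∘ D`, that is, the unique `v ∈ V` with `b (D w) = ⟪v, w⟫` for all `w`. -/
def rieszGradient {V : Type*} [NormedAddCommGroup V] [InnerProductSpace ℝ V] [CompleteSpace V]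
    (D : V →L[ℝ] B) (b : StrongDual ℝ B) : V :=
  (InnerProductSpace.toDual ℝ V).symm (b.comp D)

/-! ### Scores and tangent spaces of the semiparametric model -/

section Model

variable (P : Eucl k → H → ProbabilityMeasure 𝒳) (𝒞 : Set (ℝ → H)) (θ : Eucl k) (G : H)

/-- The model is Hellinger differentiable at `P_{θ,G}` with score operator `l`: for every `ζ` and
every path in `𝒞`, `l(ζ, Ġ)` is the tangent of `η ↦ P_{θ+ηζ, G_η}`. -/
def IsScoreOperator (l : (Eucl k × tangentSpace 𝒞) →L[ℝ] Lp ℝ 2 (P θ G : Measure 𝒳)) : Prop :=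
  (∀ v, ∫ x, (l v) x ∂(P θ G : Measure 𝒳) = 0) ∧
  ∀ ζ : Eucl k, ∀ c ∈ 𝒞, ∀ h : tangentSpace 𝒞, (h : H) = deriv c 0 →
    IsTangent (P θ G) (fun η => P (θ + η • ζ) (c η)) (l (ζ, h))

/-- The tangent space of the submodel in which `θ` is known. -/
abbrev tangentSpace₂ : Submodule ℝ (Lp ℝ 2 (P θ G : Measure 𝒳)) :=
  (Submodule.span ℝ {τ | ∃ c ∈ 𝒞, IsTangent (P θ G) (fun η => P θ (c η)) τ}).topologicalClosure

/-- The tangent space of the full model. -/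
abbrev fullTangentSpace : Submodule ℝ (Lp ℝ 2 (P θ G : Measure 𝒳)) :=
  (Submodule.span ℝ {ρ | ∃ ζ : Eucl k, ∃ c ∈ 𝒞,
    IsTangent (P θ G) (fun η => P (θ + η • ζ) (c η)) ρ}).topologicalClosure

/-- `D` is the pathwise derivative at `P_{θ,G}`, in the full model, of the parameter
`P_{θ,G} ↦ ν(G)`. -/
def IsFullPathwiseDeriv (ν : H → B) (D : fullTangentSpace P 𝒞 θ G →L[ℝ] B) : Prop :=
  ∀ ζ : Eucl k, ∀ c ∈ 𝒞, ∀ ρ : fullTangentSpace P 𝒞 θ G,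
    IsTangent (P θ G) (fun η => P (θ + η • ζ) (c η)) ρ →
    (fun η : ℝ => ν (c η) - ν G - η • D ρ) =o[𝓝 0] (fun η : ℝ => η)

end Model

section Scores

variable {𝒞 : Set (ℝ → H)} {Q : Measure 𝒳}

/-- The score functions `l̇₁` for `θ`. -/
def score₁ (l : (Eucl k × tangentSpace 𝒞) →L[ℝ] Lp ℝ 2 Q) (j : Fin k) : Lp ℝ 2 Q :=
  l (EuclideanSpace.single j 1, 0)

/-- The score operator `l̇₂` for `G`. -/
def score₂ (l : (Eucl k × tangentSpace 𝒞) →L[ℝ] Lp ℝ 2 Q) : tangentSpace 𝒞 →L[ℝ] Lp ℝ 2 Q :=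
  l.comp (ContinuousLinearMap.inr ℝ (Eucl k) (tangentSpace 𝒞))

/-- The information operator `l̇₂ᵀ l̇₂ : Ġ → Ġ`. -/
def infoOperator (l : (Eucl k × tangentSpace 𝒞) →L[ℝ] Lp ℝ 2 Q) :
    tangentSpace 𝒞 →L[ℝ] tangentSpace 𝒞 :=
  (ContinuousLinearMap.adjoint (score₂ l)).comp (score₂ l)

/-- `f` is a version of `l̇₂ (l̇₂ᵀ l̇₂)⁻ α`: the information equation `l̇₂ᵀ l̇₂ h = α` has a solution
`h ∈ Ġ` and `f = l̇₂ h` almost everywhere. -/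
def IsSubmodelInfluence (l : (Eucl k × tangentSpace 𝒞) →L[ℝ] Lp ℝ 2 Q) (α : tangentSpace 𝒞)
    (f : 𝒳 → ℝ) : Prop :=
  ∃ h : tangentSpace 𝒞, infoOperator l h = α ∧ f =ᵐ[Q] score₂ l h

end Scores

/-- The efficient score `l₁* = l̇₁ - Π(l̇₁ | Ṗ₂)` for `θ`. -/
def efficientScore (P : Eucl k → H → ProbabilityMeasure 𝒳) (𝒞 : Set (ℝ → H)) (θ : Eucl k) (G : H)
    (l : (Eucl k × tangentSpace 𝒞) →L[ℝ] Lp ℝ 2 (P θ G : Measure 𝒳)) (j : Fin k) :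
    Lp ℝ 2 (P θ G : Measure 𝒳) :=
  score₁ l j - (tangentSpace₂ P 𝒞 θ G).starProjection (score₁ l j)

/-- The efficient information matrix `I_* = E(l₁* l₁*ᵀ)` for `θ`. -/
def efficientInfo (P : Eucl k → H → ProbabilityMeasure 𝒳) (𝒞 : Set (ℝ → H)) (θ : Eucl k) (G : H)
    (l : (Eucl k × tangentSpace 𝒞) →L[ℝ] Lp ℝ 2 (P θ G : Measure 𝒳)) :
    Matrix (Fin k) (Fin k) ℝ :=
  Matrix.of fun i j => ∫ x, efficientScore P 𝒞 θ G l i x * efficientScore P 𝒞 θ G l j x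
    ∂(P θ G : Measure 𝒳)

/-! ### Asymptotics of statistics of i.i.d. samples -/

/-- `Z_n = Z_n(X_1, …, X_n) → 0` in probability, for `X_1, …, X_n` i.i.d. with law `Q`. -/
def TendstoZeroInProb (Q : ProbabilityMeasure 𝒳) (Z : (n : ℕ) → (Fin n → 𝒳) → ℝ) : Prop :=
  ∀ ε : ℝ, 0 < ε →
    Tendsto (fun n => Measure.pi (fun _ : Fin n => (Q : Measure 𝒳)) {x | ε ≤ |Z n x|})
      atTop (𝓝 0)

/-- A sequence in `Θ` with `√n (θ_n - θ₀)` bounded. -/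
def IsLocalSeq (Θ : Set (Eucl k)) (θ₀ : Eucl k) (θ : ℕ → Eucl k) : Prop :=
  (∀ n, θ n ∈ Θ) ∧ ∃ C : ℝ, ∀ n : ℕ, Real.sqrt n * ‖θ n - θ₀‖ ≤ C

/-- `√n (t_n - θ₀)` is bounded in probability when the sample is i.i.d. with law `Q`. -/
def IsRootNConsistent (Q : ProbabilityMeasure 𝒳) (θ₀ : Eucl k)
    (t : (n : ℕ) → (Fin n → 𝒳) → Eucl k) : Prop :=
  ∀ ε : ℝ, 0 < ε → ∃ M : ℝ, ∀ᶠ n : ℕ in atTop,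
    Measure.pi (fun _ : Fin n => (Q : Measure 𝒳)) {x | M < Real.sqrt n * ‖t n x - θ₀‖}
      ≤ ENNReal.ofReal ε

/-- `(X_1, …, X_m)`. -/
def firstPart {n m : ℕ} (h : m ≤ n) (x : Fin n → 𝒳) : Fin m → 𝒳 := fun i => x (Fin.castLE h i)

/-- `(X_{m+1}, …, X_n)`. -/
def secondPart {n : ℕ} (m : ℕ) (x : Fin n → 𝒳) : Fin (n - m) → 𝒳 :=
  fun i => x ⟨m + i, by have := i.isLt; omega⟩

/-- The split-sample substitution estimator: on each part of the sample the submodel estimator `u`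
is used, with the estimate of `θ` computed from the other part. -/
def splitEstimator (u : (n : ℕ) → (Fin n → 𝒳) → Eucl k → B)
    (t : (n : ℕ) → (Fin n → 𝒳) → Eucl k) {n m : ℕ} (h : m ≤ n) (x : Fin n → 𝒳) : B :=
  ((m : ℝ) / n) • u m (firstPart h x) (t (n - m) (secondPart m x)) +
    (((n : ℝ) - m) / n) • u (n - m) (secondPart m x) (t m (firstPart h x))

/-- `√n (b(û) - b(ν) - n⁻¹ ∑ f(X_i))`, the remainder in asymptotic linearity of an estimate `û` of
`ν` in the direction `b ∈ B*`, with influence function `f`. -/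
def linearRemainder (b : StrongDual ℝ B) (ν û : B) (f : 𝒳 → ℝ) {n : ℕ} (x : Fin n → 𝒳) : ℝ :=
  Real.sqrt n * (b (û - ν) - (n : ℝ)⁻¹ * ∑ i, f (x i))

end AdaptiveSplit

end

open AdaptiveSplit

/-! Differentiability in the full model means that the derivative `D` on path tangents descends to a
bounded operator on scores. The range condition represents every functional `b ∘ D` through the
score operator T for `G`, so Banach–Steinhaus gives ‖D v‖ ≤ C‖T v‖
(`exists_norm_le_of_forall_dual`), and `D = E ∘ T` with `E` bounded and zero on the orthogonal
complement of the range of T (`exists_factor_of_norm_le`). By adaptivity the scores for `θ` lie in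
that complement, so `E` ignores them, and its restriction to the full tangent space is the
derivative. The same orthogonality makes the submodel influence function its gradient. Since every
tangent is unique (`IsTangent.unique`), the values of the score operator exhaust the tangents.

For asymptotic linearity, smoothness of `ψ` in `θ` allows the moving influence function to be
replaced by one fixed measurable version at `θ₀`. The remainder of the split estimator is a
combination, with weights at most 1, of the remainders on the two parts
(`linearRemainder_splitEstimator`). On each part the plugged-in estimate is independent of the data,
so by Fubini it can be treated as a deterministic parameter within O(n^{-1/2}) of `θ₀`. This needs a
bound uniform over such parameters, which follows from convergence along every local sequence by
choosing the worst parameter for each `n` (`eventually_forall_measure_le`,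
`tendsto_measure_plugin`). Smoothness is then used once more to return to `ψ` at `θ_n`. -/

noncomputable section

namespace AdaptiveSplit

/-! ### Operators bounded by a score operator -/

section Extension

variable {V W B : Type*} [NormedAddCommGroup V] [InnerProductSpace ℝ V]
  [NormedAddCommGroup W] [InnerProductSpace ℝ W]
  [NormedAddCommGroup B] [NormedSpace ℝ B]

/-- If every functional `b ∘ D` is represented through `T`, then `D` is bounded by `T`. -/
theorem exists_norm_le_of_forall_dual (T : V →L[ℝ] W) (D : V →L[ℝ] B)
    (hT : ∀ b : StrongDual ℝ B, ∃ h : V, ∀ v, b (D v) = inner ℝ (T h) (T v)) :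
    ∃ C, ∀ v, ‖D v‖ ≤ C * ‖T v‖ := by
  -- The normalized vectors D v / ‖T v‖, seen in the bidual, are bounded pointwise on the dual by
  -- Cauchy–Schwarz. The uniform bound is the claim.
  obtain ⟨C, hC⟩ := banach_steinhaus
    (g := fun v : V => (‖T v‖)⁻¹ • NormedSpace.inclusionInDoubleDual ℝ B (D v)) (by
      intro b
      obtain ⟨h, hh⟩ := hT b
      refine ⟨‖T h‖, fun v => ?_⟩
      simp only [_root_.smul_apply, NormedSpace.dual_def, hh, norm_smul, norm_inv,
        norm_norm]
      rcases eq_or_ne (‖T v‖) 0 with h0 | h0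
      · simp [h0]
      · rw [inv_mul_le_iff₀ (by positivity), mul_comm]
        exact norm_inner_le_norm _ _)
  refine ⟨C, fun v => ?_⟩
  -- For T v = 0 the normalizing factor is 0 and the uniform bound is void; `D v` vanishes because
  -- the dual separates points.
  rcases eq_or_ne (T v) 0 with h0 | h0
  · have : D v = 0 := by
      refine SeparatingDual.eq_zero_of_forall_dual_eq_zero (R := ℝ) fun b => ?_
      obtain ⟨h, hh⟩ := hT b
      rw [hh, h0, inner_zero_right]
    simp [this, h0]
  · have h1 := hC v
    have h2 : ‖NormedSpace.inclusionInDoubleDual ℝ B (D v)‖ = ‖D v‖ :=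
      (NormedSpace.inclusionInDoubleDualLi ℝ (E := B)).norm_map (D v)
    rw [norm_smul, norm_inv, norm_norm, h2, inv_mul_le_iff₀ (norm_pos_iff.2 h0)] at h1
    linarith

/-- An operator bounded by `T` factors through `T`, by a bounded operator that vanishes on the
orthogonal complement of the range of `T`. -/
theorem exists_factor_of_norm_le [CompleteSpace W] [CompleteSpace B] (T : V →L[ℝ] W)
    (D : V →L[ℝ] B) (hT : ∃ C, ∀ v, ‖D v‖ ≤ C * ‖T v‖) :
    ∃ E : W →L[ℝ] B, (∀ v, E (T v) = D v) ∧
      ∀ w, (∀ v, inner ℝ w (T v) = 0) → E w = 0 := by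
  set K : Submodule ℝ W := (LinearMap.range T.toLinearMap).topologicalClosure with hK
  have hmem : ∀ v, T v ∈ K := fun v => Submodule.le_topologicalClosure _ ⟨v, rfl⟩
  set T' : V →ₗ[ℝ] K := T.toLinearMap.codRestrict K hmem with hT'
  have hdense : DenseRange T' := by
    intro x
    rw [closure_subtype]
    have hx : (x : W) ∈ closure (LinearMap.range T.toLinearMap : Set W) := x.2
    refine closure_mono ?_ hx
    rintro _ ⟨v, rfl⟩
    exact ⟨T' v, ⟨v, rfl⟩, rfl⟩
  have hfac : ∀ v, LinearMap.extendOfNorm D.toLinearMap T' (T' v) = D v := fun v =>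
    LinearMap.extendOfNorm_eq hdense hT v
  have : CompleteSpace K := (Submodule.isClosed_topologicalClosure _).completeSpace_coe
  -- Extend by density to the closure of the range, then precompose with the projection onto it; the
  -- projection is what kills the complement.
  refine ⟨(LinearMap.extendOfNorm D.toLinearMap T').comp K.orthogonalProjectionOnto, fun v => ?_,
    fun w hw => ?_⟩
  · have : K.orthogonalProjectionOnto (T v) = T' v :=
      Submodule.orthogonalProjectionOnto_mem_subspace_eq_self (T' v)
    simp only [ContinuousLinearMap.comp_apply, this, hfac]
  · have : w ∈ Kᗮ := by
      rw [hK, Submodule.orthogonal_closure, Submodule.mem_orthogonal']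
      rintro _ ⟨v, rfl⟩
      exact hw v
    have : K.orthogonalProjectionOnto w = 0 :=
      Submodule.orthogonalProjectionOnto_apply_of_mem_orthogonal this
    simp [this]

end Extension

/-! ### Uniqueness of tangents -/

section Uniqueness

variable {𝒳 : Type*} [MeasurableSpace 𝒳]

theorem measurable_rootDensity (μ : Measure 𝒳) (Q : ProbabilityMeasure 𝒳) :
    Measurable (rootDensity μ Q) :=
  ((Measure.measurable_rnDeriv _ _).ennreal_toReal).sqrt

/-- The root density with respect to a larger dominating measure. -/
theorem rootDensity_trans {μ κ : Measure 𝒳} [SigmaFinite μ] [SigmaFinite κ]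
    {Q : ProbabilityMeasure 𝒳} (hQ : (Q : Measure 𝒳) ≪ μ) :
    rootDensity κ Q =ᵐ[κ] fun x => rootDensity μ Q x * Real.sqrt ((μ.rnDeriv κ x).toReal) := by
  filter_upwards [Measure.rnDeriv_mul_rnDeriv (κ := κ) hQ] with x hx
  simp only [rootDensity, ← hx, Pi.mul_apply, ENNReal.toReal_mul]
  exact Real.sqrt_mul ENNReal.toReal_nonneg _

/-- Squaring turns the extra factor into the density of `μ` with respect to `κ`, so this is a change
of measure. -/
theorem eLpNorm_mul_sqrt_rnDeriv {μ κ : Measure 𝒳} [SigmaFinite μ] [SigmaFinite κ]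
    (hμ : μ ≪ κ) {f : 𝒳 → ℝ} (hf : Measurable f) :
    eLpNorm (fun x => f x * Real.sqrt ((μ.rnDeriv κ x).toReal)) 2 κ = eLpNorm f 2 μ := by
  rw [eLpNorm_eq_lintegral_rpow_enorm_toReal (by norm_num) (by norm_num),
    eLpNorm_eq_lintegral_rpow_enorm_toReal (by norm_num) (by norm_num),
    ← lintegral_rnDeriv_mul hμ (by fun_prop)]
  congr 1
  refine lintegral_congr_ae ?_
  filter_upwards [Measure.rnDeriv_lt_top μ κ] with x hx
  simp only [ENNReal.toReal_ofNat, ENNReal.rpow_ofNat, enorm_mul, mul_pow]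
  rw [mul_comm]
  congr 1
  rw [Real.enorm_of_nonneg (Real.sqrt_nonneg _), ← ENNReal.ofReal_pow
    (Real.sqrt_nonneg _), Real.sq_sqrt ENNReal.toReal_nonneg, ENNReal.ofReal_toReal hx.ne]

/-- `∫ |f s|² dμ = ∫ |f|² dQ` for the root density `s` of `Q`. -/
theorem eLpNorm_mul_rootDensity {μ : Measure 𝒳} [SigmaFinite μ] {Q : ProbabilityMeasure 𝒳}
    (hQ : (Q : Measure 𝒳) ≪ μ) {f : 𝒳 → ℝ} (hf : Measurable f) :
    eLpNorm (fun x => f x * rootDensity μ Q x) 2 μ = eLpNorm f 2 (Q : Measure 𝒳) :=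
  eLpNorm_mul_sqrt_rnDeriv hQ hf

/-- The remainder in the definition of the tangent. -/
def tangentRemainder (μ : Measure 𝒳) (P₀ : ProbabilityMeasure 𝒳) (Q : ProbabilityMeasure 𝒳)
    (ρ : 𝒳 → ℝ) (η : ℝ) (x : 𝒳) : ℝ :=
  rootDensity μ Q x - rootDensity μ P₀ x - (1 / 2) * η * ρ x * rootDensity μ P₀ x

theorem measurable_tangentRemainder (μ : Measure 𝒳) (P₀ Q : ProbabilityMeasure 𝒳)
    {ρ : 𝒳 → ℝ} (hρ : Measurable ρ) (η : ℝ) : Measurable (tangentRemainder μ P₀ Q ρ η) := by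
  have h1 := measurable_rootDensity μ P₀
  have h2 := measurable_rootDensity μ Q
  unfold tangentRemainder
  fun_prop

/-- Every term of the remainder carries the same factor √(dμ/dκ). Hence tangents defined by
different dominating measures can be compared over a common one. -/
theorem eLpNorm_tangentRemainder_trans {μ κ : Measure 𝒳} [SigmaFinite μ] [SigmaFinite κ]
    (hμ : μ ≪ κ) {P₀ Q : ProbabilityMeasure 𝒳} (hP : (P₀ : Measure 𝒳) ≪ μ)
    (hQ : (Q : Measure 𝒳) ≪ μ) {ρ : 𝒳 → ℝ} (hρ : Measurable ρ) (η : ℝ) :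
    eLpNorm (tangentRemainder κ P₀ Q ρ η) 2 κ = eLpNorm (tangentRemainder μ P₀ Q ρ η) 2 μ := by
  rw [← eLpNorm_mul_sqrt_rnDeriv hμ (measurable_tangentRemainder μ P₀ Q hρ η)]
  refine eLpNorm_congr_ae ?_
  filter_upwards [rootDensity_trans (κ := κ) hP, rootDensity_trans (κ := κ) hQ] with x h1 h2
  simp only [tangentRemainder, h1, h2]
  ring

/-- Finiteness matters because `toReal` sends an infinite norm to 0. -/
theorem memLp_tangentRemainder {μ : Measure 𝒳} [SigmaFinite μ]
    {P₀ Q : ProbabilityMeasure 𝒳} (hP : (P₀ : Measure 𝒳) ≪ μ)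
    (hQ : (Q : Measure 𝒳) ≪ μ) {ρ : 𝒳 → ℝ} (hρ : Measurable ρ)
    (hρ2 : MemLp ρ 2 (P₀ : Measure 𝒳)) (η : ℝ) :
    MemLp (tangentRemainder μ P₀ Q ρ η) 2 μ := by
  have key : ∀ {R : ProbabilityMeasure 𝒳}, (R : Measure 𝒳) ≪ μ → ∀ {f : 𝒳 → ℝ}, Measurable f →
      MemLp f 2 (R : Measure 𝒳) → MemLp (fun x => f x * rootDensity μ R x) 2 μ :=
    fun {R} hR {f} hf hf2 => ⟨(hf.mul (measurable_rootDensity μ R)).aestronglyMeasurable,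
      by rw [eLpNorm_mul_rootDensity hR hf]; exact hf2.2⟩
  have h1 := key hP (f := fun _ => 1) measurable_const (memLp_const 1)
  have h2 := key hQ (f := fun _ => 1) measurable_const (memLp_const 1)
  have h3 := key hP (f := fun x => (1 / 2) * η * ρ x) (by fun_prop) (hρ2.const_mul _)
  simp only [one_mul] at h1 h2
  exact (h2.sub h1).sub h3

/-- The tangent of a one-dimensional family is unique. -/
theorem IsTangent.unique {P₀ : ProbabilityMeasure 𝒳} {Q : ℝ → ProbabilityMeasure 𝒳}
    {ρ ρ' : Lp ℝ 2 (P₀ : Measure 𝒳)} (h : IsTangent P₀ Q ρ) (h' : IsTangent P₀ Q ρ') :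
    ρ = ρ' := by
  obtain ⟨-, μ, _, hPμ, hQμ, ho⟩ := h
  obtain ⟨-, μ', _, hPμ', hQμ', ho'⟩ := h'
  have hρ : Measurable ρ := (Lp.stronglyMeasurable ρ).measurable
  have hρ' : Measurable ρ' := (Lp.stronglyMeasurable ρ').measurable
  set κ := μ + μ' with hκ
  have hμ : μ ≪ κ := Measure.absolutelyContinuous_of_le (Measure.le_add_right le_rfl)
  have hμ' : μ' ≪ κ := Measure.absolutelyContinuous_of_le (Measure.le_add_left le_rfl)
  have hPκ := hPμ.trans hμ
  set N : ℝ := (eLpNorm (fun x => ρ x - ρ' x) 2 (P₀ : Measure 𝒳)).toReal with hN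
  -- The two remainders over `κ` differ by (η/2)(ρ - ρ')s₀, whose norm is |η|N/2.
  have hbound : ∀ᶠ η : ℝ in 𝓝 0, ‖(1 / 2) * η * N‖ ≤
      ‖(eLpNorm (tangentRemainder μ P₀ (Q η) ρ η) 2 μ).toReal
        + (eLpNorm (tangentRemainder μ' P₀ (Q η) ρ' η) 2 μ').toReal‖ := by
    filter_upwards [hQμ, hQμ'] with η h1 h2
    have m1 := memLp_tangentRemainder hPκ (h1.trans hμ) hρ (Lp.memLp ρ) η
    have m2 := memLp_tangentRemainder hPκ (h1.trans hμ) hρ' (Lp.memLp ρ') η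
    rw [← eLpNorm_tangentRemainder_trans hμ hPμ h1 hρ η,
      ← eLpNorm_tangentRemainder_trans hμ' hPμ' h2 hρ' η,
      ← ENNReal.toReal_add m1.2.ne m2.2.ne, Real.norm_of_nonneg ENNReal.toReal_nonneg]
    have e : ‖(1 / 2) * η * N‖ =
        (eLpNorm (fun x => ((1 / 2) * η) * (ρ x - ρ' x)) 2 (P₀ : Measure 𝒳)).toReal := by
      have := eLpNorm_const_smul ((1 / 2) * η) (fun x => ρ x - ρ' x) 2 (P₀ : Measure 𝒳)
      rw [show (fun x => ((1 / 2) * η) * (ρ x - ρ' x)) =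
        ((1 / 2) * η) • fun x => ρ x - ρ' x from rfl, this, ENNReal.toReal_mul, toReal_enorm,
        norm_mul, hN, Real.norm_of_nonneg (r := ENNReal.toReal _) ENNReal.toReal_nonneg]
    rw [e, ← eLpNorm_mul_rootDensity hPκ (by fun_prop)]
    refine ENNReal.toReal_mono (ENNReal.add_lt_top.2 ⟨m1.2, m2.2⟩).ne ?_
    rw [add_comm]
    refine le_trans (le_of_eq ?_) (eLpNorm_sub_le m2.1 m1.1 (by norm_num))
    congr 1
    ext x
    simp only [tangentRemainder, Pi.sub_apply]
    ring
  have hsmall : (fun η : ℝ => (1 / 2) * η * N) =o[𝓝 0] (fun η : ℝ => η) :=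
    (IsBigO.of_bound' hbound).trans_isLittleO (ho.add ho')
  have hN0 : N = 0 := by
    by_contra hne
    have h2 : (fun η : ℝ => η) =o[𝓝 0] (fun η : ℝ => η) := by
      refine (hsmall.const_mul_left (2 * N⁻¹)).congr_left fun η => ?_
      field_simp
    refine isLittleO_irrefl' ?_ h2
    have hne : ∀ᶠ η : ℝ in 𝓝[>] 0, ‖η‖ ≠ 0 :=
      eventually_mem_nhdsWithin.mono fun η hη => norm_ne_zero_iff.2 (ne_of_gt hη)
    exact hne.frequently.filter_mono nhdsWithin_le_nhds
  have h0 : eLpNorm (fun x => ρ x - ρ' x) 2 (P₀ : Measure 𝒳) = 0 :=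
    ((ENNReal.toReal_eq_zero_iff _).1 hN0).resolve_right
      ((Lp.memLp ρ).sub (Lp.memLp ρ')).2.ne
  rw [eLpNorm_eq_zero_iff (by fun_prop) (by norm_num)] at h0
  refine Lp.ext ?_
  filter_upwards [h0] with x hx
  simpa [sub_eq_zero] using hx

end Uniqueness

/-! ### Convergence in probability of statistics of i.i.d. samples -/

theorem sum_eq_sum_parts {𝒳 : Type*} {n m : ℕ} (h : m ≤ n) (f : 𝒳 → ℝ) (x : Fin n → 𝒳) :
    ∑ i, f (x i) = ∑ i, f (firstPart h x i) + ∑ i, f (secondPart m x i) := by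
  let e : Fin m ⊕ Fin (n - m) ≃ Fin n := finSumFinEquiv.trans (finCongr (by omega))
  rw [← e.sum_comp, Fintype.sum_sum_type]
  rfl

/-- The remainder of the split-sample estimator, in terms of those on the two parts. -/
theorem linearRemainder_splitEstimator {𝒳 : Type*} {k : ℕ} {B : Type*} [NormedAddCommGroup B] [NormedSpace ℝ B]
    (b : StrongDual ℝ B) (ν : B) (f : 𝒳 → ℝ) (u : (n : ℕ) → (Fin n → 𝒳) → Eucl k → B)
    (t : (n : ℕ) → (Fin n → 𝒳) → Eucl k) {n m : ℕ} (h : m ≤ n) (x : Fin n → 𝒳) :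
    linearRemainder b ν (splitEstimator u t h x) f x =
      Real.sqrt m / Real.sqrt n *
        linearRemainder b ν (u m (firstPart h x) (t (n - m) (secondPart m x))) f (firstPart h x) +
      Real.sqrt (n - m : ℕ) / Real.sqrt n *
        linearRemainder b ν (u (n - m) (secondPart m x) (t m (firstPart h x))) f
          (secondPart m x) := by
  rcases Nat.eq_zero_or_pos n with rfl | hn
  · simp [linearRemainder]
  -- With the weight included, the inner normalization by `j` disappears and the two parts simply
  -- add. An empty part contributes 0 on both sides.
  have key : ∀ (j : ℕ) (y : Fin j → 𝒳) (v : B), Real.sqrt j / Real.sqrt n *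
      linearRemainder b ν v f y = (Real.sqrt n)⁻¹ * (j * b (v - ν) - ∑ i, f (y i)) := by
    intro j y v
    rcases Nat.eq_zero_or_pos j with rfl | hj
    · simp [linearRemainder]
    have hj' : (0 : ℝ) < j := by exact_mod_cast hj
    have hs : Real.sqrt j * Real.sqrt j = j := Real.mul_self_sqrt hj'.le
    rw [linearRemainder, div_eq_inv_mul, mul_assoc, ← mul_assoc (Real.sqrt j), hs]
    field_simp
  have hn' : (0 : ℝ) < n := by exact_mod_cast hn
  have hs : Real.sqrt n * Real.sqrt n = n := Real.mul_self_sqrt hn'.le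
  have hsn : Real.sqrt n ≠ 0 := (Real.sqrt_pos.2 hn').ne'
  have hn2 : (n : ℝ)⁻¹ * Real.sqrt n = (Real.sqrt n)⁻¹ := by
    field_simp
    rw [sq, hs]
  rw [key, key, linearRemainder, sum_eq_sum_parts h, splitEstimator, ← hn2, Nat.cast_sub h]
  simp only [map_sub, map_add, map_smul, smul_eq_mul]
  field_simp
  ring

section Sampling

variable {𝒳 : Type*} [MeasurableSpace 𝒳] {k : ℕ} {Q : ProbabilityMeasure 𝒳}

theorem TendstoZeroInProb.sub {Z W : (n : ℕ) → (Fin n → 𝒳) → ℝ} (hZ : TendstoZeroInProb Q Z)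
    (hW : TendstoZeroInProb Q W) : TendstoZeroInProb Q (fun n x => Z n x - W n x) := by
  intro ε hε
  have hsum := (hZ (ε / 2) (half_pos hε)).add (hW (ε / 2) (half_pos hε))
  rw [add_zero] at hsum
  refine tendsto_of_tendsto_of_tendsto_of_le_of_le tendsto_const_nhds hsum (fun _ => zero_le)
    fun n => ?_
  refine (measure_mono fun x hx => ?_).trans (measure_union_le _ _)
  simp only [Set.mem_ofPred_eq, Set.mem_union] at hx ⊢
  by_contra! hcon
  linarith [abs_sub (Z n x) (W n x)]

theorem TendstoZeroInProb.neg {Z : (n : ℕ) → (Fin n → 𝒳) → ℝ} (hZ : TendstoZeroInProb Q Z) :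
    TendstoZeroInProb Q (fun n x => -Z n x) := by
  simpa only [TendstoZeroInProb, abs_neg] using hZ

theorem TendstoZeroInProb.congr_ae {Z W : (n : ℕ) → (Fin n → 𝒳) → ℝ}
    (hZ : TendstoZeroInProb Q Z)
    (h : ∀ n, Z n =ᵐ[Measure.pi (fun _ : Fin n => (Q : Measure 𝒳))] W n) :
    TendstoZeroInProb Q W := by
  intro ε hε
  refine (hZ ε hε).congr fun n => measure_congr ?_
  filter_upwards [h n] with x hx
  change (ε ≤ |Z n x|) = (ε ≤ |W n x|)
  rw [hx]

/-- Lets an arbitrary version of an influence function be exchanged for a measurable one inside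
sample sums. -/
theorem ae_pi_forall_eq {f g : 𝒳 → ℝ} (h : f =ᵐ[(Q : Measure 𝒳)] g) (n : ℕ) :
    ∀ᵐ x ∂Measure.pi (fun _ : Fin n => (Q : Measure 𝒳)), ∀ i, f (x i) = g (x i) :=
  ae_all_iff.2 fun i =>
    (Measure.quasiMeasurePreserving_eval (μ := fun _ : Fin n => (Q : Measure 𝒳)) i).ae h

/-- The two parts of an i.i.d. sample are independent i.i.d. samples. -/
theorem measurePreserving_split (Q : ProbabilityMeasure 𝒳) {n m : ℕ} (h : m ≤ n) :
    MeasurePreserving (fun x : Fin n → 𝒳 => (firstPart h x, secondPart m x))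
      (Measure.pi fun _ => (Q : Measure 𝒳))
      ((Measure.pi fun _ => (Q : Measure 𝒳)).prod (Measure.pi fun _ => (Q : Measure 𝒳))) := by
  let e : Fin m ⊕ Fin (n - m) ≃ Fin n := finSumFinEquiv.trans (finCongr (by omega))
  have h1 := (measurePreserving_piCongrLeft (fun _ : Fin n => (Q : Measure 𝒳)) e).symm
  have h2 := measurePreserving_sumPiEquivProdPi
    (fun _ : Fin m ⊕ Fin (n - m) => (Q : Measure 𝒳))
  exact h2.comp h1

/-- Convergence in probability along all local sequences is uniform over local neighbourhoods. -/
theorem eventually_forall_measure_le {Θ : Set (Eucl k)} (hΘ : IsOpen Θ) {θ₀ : Eucl k}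
    (hθ₀ : θ₀ ∈ Θ) {Z : (n : ℕ) → (Fin n → 𝒳) → Eucl k → ℝ}
    (hZ : ∀ θ : ℕ → Eucl k, IsLocalSeq Θ θ₀ θ → TendstoZeroInProb Q (fun n x => Z n x (θ n)))
    (M : ℝ) {ε : ℝ} (hε : 0 < ε) {δ : ENNReal} (hδ : 0 < δ) :
    ∀ᶠ n : ℕ in atTop, ∀ θ : Eucl k, Real.sqrt n * ‖θ - θ₀‖ ≤ M →
      Measure.pi (fun _ : Fin n => (Q : Measure 𝒳)) {x | ε ≤ |Z n x θ|} ≤ δ := by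
  classical
  have hsub : ∀ᶠ n : ℕ in atTop, ∀ θ : Eucl k, Real.sqrt n * ‖θ - θ₀‖ ≤ M → θ ∈ Θ := by
    obtain ⟨r, hr, hball⟩ := Metric.isOpen_iff.1 hΘ θ₀ hθ₀
    have hlim : Tendsto (fun n : ℕ => Real.sqrt n) atTop atTop :=
      Real.tendsto_sqrt_atTop.comp tendsto_natCast_atTop_atTop
    filter_upwards [hlim.eventually_gt_atTop (M / r), eventually_gt_atTop 0] with n hn hn0 θ hθ
    refine hball ?_
    rw [Metric.mem_ball, dist_eq_norm]
    by_contra! hcon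
    have h0 : 0 ≤ Real.sqrt n := Real.sqrt_nonneg _
    rw [div_lt_iff₀ hr] at hn
    nlinarith
  let bad (n : ℕ) (θ : Eucl k) : Prop := θ ∈ Θ ∧ Real.sqrt n * ‖θ - θ₀‖ ≤ M ∧
    δ < Measure.pi (fun _ : Fin n => (Q : Measure 𝒳)) {x | ε ≤ |Z n x θ|}
  -- A bad parameter is selected whenever one exists. The result is itself a local sequence, so
  -- convergence along it rules out bad parameters for large `n`.
  let θ : ℕ → Eucl k := fun n => if h : ∃ τ, bad n τ then h.choose else θ₀
  have hloc : IsLocalSeq Θ θ₀ θ := by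
    refine ⟨fun n => ?_, max M 0, fun n => ?_⟩
    · by_cases h : ∃ τ, bad n τ
      · simp only [θ, dif_pos h]; exact h.choose_spec.1
      · simpa only [θ, dif_neg h] using hθ₀
    · by_cases h : ∃ τ, bad n τ
      · simp only [θ, dif_pos h]; exact h.choose_spec.2.1.trans (le_max_left _ _)
      · simp only [θ, dif_neg h]; simp
  filter_upwards [hsub, ENNReal.tendsto_nhds_zero.1 (hZ θ hloc ε hε) δ hδ] with n h1 h2 τ hτ
  by_contra! hcon
  have h : ∃ τ, bad n τ := ⟨τ, h1 τ hτ, hτ, hcon⟩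
  have h3 : bad n (θ n) := by simp only [θ, dif_pos h]; exact h.choose_spec
  exact absurd h2 (not_le.2 h3.2.2)

/-- A statistic that vanishes in probability along all local sequences also does so at an
independent `√n`-consistent estimate. -/
theorem tendsto_measure_plugin {Θ : Set (Eucl k)} (hΘ : IsOpen Θ) {θ₀ : Eucl k}
    (hθ₀ : θ₀ ∈ Θ) {Z : (n : ℕ) → (Fin n → 𝒳) → Eucl k → ℝ}
    (hmeas : ∀ n, Measurable (fun p : (Fin n → 𝒳) × Eucl k => Z n p.1 p.2))
    (hZ : ∀ θ : ℕ → Eucl k, IsLocalSeq Θ θ₀ θ → TendstoZeroInProb Q (fun n x => Z n x (θ n)))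
    {t : (n : ℕ) → (Fin n → 𝒳) → Eucl k} (ht_meas : ∀ n, Measurable (t n))
    (ht : IsRootNConsistent Q θ₀ t) {a c : ℕ → ℕ} (ha : Tendsto a atTop atTop)
    (hc : Tendsto c atTop atTop) {C : ℝ} (hC : 0 ≤ C)
    (hac : ∀ᶠ n in atTop, Real.sqrt (a n) ≤ C * Real.sqrt (c n)) {ε : ℝ} (hε : 0 < ε) :
    Tendsto (fun n => ((Measure.pi fun _ : Fin (a n) => (Q : Measure 𝒳)).prod
      (Measure.pi fun _ : Fin (c n) => (Q : Measure 𝒳)))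
        {p | ε ≤ |Z (a n) p.1 (t (c n) p.2)|}) atTop (𝓝 0) := by
  refine ENNReal.tendsto_nhds_zero.2 fun δ hδ => ?_
  -- A finite `r` is needed since `δ` may be infinite; half of it goes to a nonlocal estimate and
  -- half to a large statistic.
  obtain ⟨r, hr0, hrδ⟩ := ENNReal.lt_iff_exists_nnreal_btwn.1 hδ
  have hr : (0 : ℝ) < r := by exact_mod_cast hr0
  obtain ⟨M, hM⟩ := ht (r / 2) (half_pos hr)
  -- An estimate within M/√(c n) of `θ₀` is within C·M/√(a n), the scale of the other sample.
  have hunif := eventually_forall_measure_le hΘ hθ₀ hZ (C * M) hε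
    (ENNReal.ofReal_pos.2 (half_pos hr))
  filter_upwards [hc.eventually hM, ha.eventually hunif, hac] with n h1 h2 h3
  set μa := Measure.pi fun _ : Fin (a n) => (Q : Measure 𝒳)
  set μc := Measure.pi fun _ : Fin (c n) => (Q : Measure 𝒳)
  set S : Set (Fin (c n) → 𝒳) := {y | M < Real.sqrt (c n) * ‖t (c n) y - θ₀‖} with hS
  have hSm : MeasurableSet S := by
    have := ht_meas (c n)
    exact measurableSet_lt measurable_const (by fun_prop)
  set A : Set ((Fin (a n) → 𝒳) × (Fin (c n) → 𝒳)) := {p | ε ≤ |Z (a n) p.1 (t (c n) p.2)|}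
  have hAm : MeasurableSet A := by
    have : Measurable fun p : (Fin (a n) → 𝒳) × (Fin (c n) → 𝒳) => Z (a n) p.1 (t (c n) p.2) :=
      (hmeas (a n)).comp (measurable_fst.prodMk ((ht_meas (c n)).comp measurable_snd))
    exact measurableSet_le measurable_const this.abs
  have hcover : A ⊆ Set.univ ×ˢ S ∪ A ∩ Set.univ ×ˢ Sᶜ := by
    rintro p hp
    by_cases hpS : p.2 ∈ S
    · exact Or.inl ⟨trivial, hpS⟩
    · exact Or.inr ⟨hp, trivial, hpS⟩
  have hfirst : (μa.prod μc) (Set.univ ×ˢ S) ≤ ENNReal.ofReal (r / 2) := by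
    rw [Measure.prod_prod, measure_univ, one_mul]
    exact h1
  have hsecond : (μa.prod μc) (A ∩ Set.univ ×ˢ Sᶜ) ≤ ENNReal.ofReal (r / 2) := by
    -- Fubini: with the second sample frozen, its estimate is a fixed local parameter and the
    -- uniform bound applies to the slice.
    rw [Measure.prod_apply_symm (hAm.inter (MeasurableSet.univ.prod hSm.compl))]
    calc _ ≤ ∫⁻ _, ENNReal.ofReal (r / 2) ∂μc := lintegral_mono fun y => ?_
      _ = _ := by simp
    by_cases hy : y ∈ S
    · refine (le_of_eq ?_).trans (zero_le)
      convert measure_empty (μ := μa)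
      ext x
      simp [hy]
    · refine (measure_mono fun x hx => hx.1).trans (h2 (t (c n) y) ?_)
      have hy' : Real.sqrt (c n) * ‖t (c n) y - θ₀‖ ≤ M := not_lt.1 hy
      calc _ ≤ C * Real.sqrt (c n) * ‖t (c n) y - θ₀‖ := by gcongr
        _ = C * (Real.sqrt (c n) * ‖t (c n) y - θ₀‖) := by ring
        _ ≤ C * M := by gcongr
  calc (μa.prod μc) A ≤ ENNReal.ofReal (r / 2) + ENNReal.ofReal (r / 2) :=
        (measure_mono hcover).trans ((measure_union_le _ _).trans (add_le_add hfirst hsecond))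
    _ = r := by
        rw [← ENNReal.ofReal_add (by positivity) (by positivity), add_halves,
          ENNReal.ofReal_coe_nnreal]
    _ ≤ δ := hrδ.le

/-- Both parts of the split contain a fixed proportion of the sample. -/
theorem exists_le_split {lam : ℕ → ℕ} (hlam : ∀ n, lam n ≤ n)
    (hlam_inf : 0 < liminf (fun n : ℕ => (lam n : ℝ) / n) atTop)
    (hlam_sup : limsup (fun n : ℕ => (lam n : ℝ) / n) atTop < 1) :
    ∃ c : ℝ, 0 < c ∧ ∀ᶠ n : ℕ in atTop, c * n ≤ lam n ∧ c * n ≤ (n - lam n : ℕ) := by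
  have h0 : ∀ n : ℕ, 0 ≤ (lam n : ℝ) / n := fun n => by positivity
  have h1 : ∀ n : ℕ, (lam n : ℝ) / n ≤ 1 := fun n =>
    div_le_one_of_le₀ (by exact_mod_cast hlam n) (by positivity)
  obtain ⟨c, hc0, hc⟩ := exists_between hlam_inf
  obtain ⟨d, hd, hd1⟩ := exists_between hlam_sup
  have e1 := eventually_lt_of_lt_liminf hc ⟨0, eventually_map.2 (Eventually.of_forall h0)⟩
  have e2 := eventually_lt_of_limsup_lt hd ⟨1, eventually_map.2 (Eventually.of_forall h1)⟩
  refine ⟨min c (1 - d), lt_min hc0 (by linarith), ?_⟩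
  filter_upwards [e1, e2, eventually_gt_atTop 0] with n g1 g2 hn
  have hn' : (0 : ℝ) < n := by exact_mod_cast hn
  rw [lt_div_iff₀ hn'] at g1
  rw [div_lt_iff₀ hn'] at g2
  rw [Nat.cast_sub (hlam n)]
  constructor
  · nlinarith [min_le_left c (1 - d)]
  · nlinarith [min_le_right c (1 - d)]

theorem tendsto_atTop_of_le_mul {c : ℝ} (hc : 0 < c) {a : ℕ → ℕ}
    (h : ∀ᶠ n : ℕ in atTop, c * n ≤ a n) : Tendsto a atTop atTop := by
  rw [← tendsto_natCast_atTop_iff (R := ℝ)]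
  exact tendsto_atTop_mono' _ h (tendsto_natCast_atTop_atTop.const_mul_atTop hc)

theorem sqrt_le_of_mul_le {c : ℝ} (hc : 0 < c) {n a d : ℕ} (ha : a ≤ n) (h : c * n ≤ d) :
    Real.sqrt a ≤ Real.sqrt c⁻¹ * Real.sqrt d := by
  rw [← Real.sqrt_mul (by positivity)]
  refine Real.sqrt_le_sqrt ?_
  rw [inv_mul_eq_div, le_div_iff₀ hc]
  have : (a : ℝ) ≤ n := by exact_mod_cast ha
  nlinarith

/-- Asymptotic linearity of the split-sample estimator. -/
theorem tendsto_linearRemainder_splitEstimator {B : Type*} [NormedAddCommGroup B]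
    [NormedSpace ℝ B] {Θ : Set (Eucl k)} (hΘ : IsOpen Θ) {θ₀ : Eucl k} (hθ₀ : θ₀ ∈ Θ)
    {b : StrongDual ℝ B} {ν : B} {f : 𝒳 → ℝ} (hf : Measurable f)
    {u : (n : ℕ) → (Fin n → 𝒳) → Eucl k → B}
    (hu_meas : ∀ n, Measurable (fun p : (Fin n → 𝒳) × Eucl k => b (u n p.1 p.2)))
    (hu : ∀ θ : ℕ → Eucl k, IsLocalSeq Θ θ₀ θ →
      TendstoZeroInProb Q (fun n x => linearRemainder b ν (u n x (θ n)) f x))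
    {t : (n : ℕ) → (Fin n → 𝒳) → Eucl k} (ht_meas : ∀ n, Measurable (t n))
    (ht : IsRootNConsistent Q θ₀ t) {lam : ℕ → ℕ} (hlam : ∀ n, lam n ≤ n)
    (hlam_inf : 0 < liminf (fun n : ℕ => (lam n : ℝ) / n) atTop)
    (hlam_sup : limsup (fun n : ℕ => (lam n : ℝ) / n) atTop < 1) :
    TendstoZeroInProb Q
      (fun n x => linearRemainder b ν (splitEstimator u t (hlam n) x) f x) := by
  intro ε hε
  obtain ⟨c, hc, hlc⟩ := exists_le_split hlam hlam_inf hlam_sup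
  have hmeas : ∀ n, Measurable
      (fun p : (Fin n → 𝒳) × Eucl k => linearRemainder b ν (u n p.1 p.2) f p.1) := by
    intro n
    have hsum : Measurable (fun p : (Fin n → 𝒳) × Eucl k => ∑ i, f (p.1 i)) :=
      Finset.measurable_sum _ fun i _ => hf.comp ((measurable_pi_apply i).comp measurable_fst)
    simp only [linearRemainder, map_sub]
    exact (((hu_meas n).sub_const _).sub (hsum.const_mul _)).const_mul _
  have ha := tendsto_atTop_of_le_mul hc (hlc.mono fun n h => h.1)
  have hd := tendsto_atTop_of_le_mul hc (hlc.mono fun n h => h.2)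
  have lim1 := tendsto_measure_plugin
    (Z := fun n x θ => linearRemainder b ν (u n x θ) f x) hΘ hθ₀ hmeas hu ht_meas ht ha hd (Real.sqrt_nonneg c⁻¹)
    (hlc.mono fun n h => sqrt_le_of_mul_le hc (hlam n) h.2) (half_pos hε)
  have lim2 := tendsto_measure_plugin
    (Z := fun n x θ => linearRemainder b ν (u n x θ) f x) hΘ hθ₀ hmeas hu ht_meas ht hd ha (Real.sqrt_nonneg c⁻¹)
    (hlc.mono fun n h => sqrt_le_of_mul_le hc (Nat.sub_le n (lam n)) h.1) (half_pos hε)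
  have hsum := lim1.add lim2
  rw [add_zero] at hsum
  refine tendsto_of_tendsto_of_tendsto_of_le_of_le tendsto_const_nhds hsum (fun _ => zero_le)
    fun n => ?_
  have hmeas' : ∀ i j : ℕ, MeasurableSet {p : (Fin i → 𝒳) × (Fin j → 𝒳) |
      ε / 2 ≤ |linearRemainder b ν (u i p.1 (t j p.2)) f p.1|} := fun i j =>
    measurableSet_le measurable_const
      ((hmeas i).comp (measurable_fst.prodMk ((ht_meas j).comp measurable_snd))).abs
  have split := measurePreserving_split Q (hlam n)
  -- In the second term the parts exchange roles: the second supplies the data, the first the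
  -- estimate.
  have swap := Measure.measurePreserving_swap.comp split
  have m1 := split.measure_preimage (hmeas' (lam n) (n - lam n)).nullMeasurableSet
  have m2 := swap.measure_preimage (hmeas' (n - lam n) (lam n)).nullMeasurableSet
  refine le_trans ?_ (add_le_add m1.le m2.le)
  refine (measure_mono fun x hx => ?_).trans (measure_union_le _ _)
  simp only [Set.mem_ofPred_eq, Set.mem_union, Set.mem_preimage, Function.comp_apply,
    Prod.fst_swap, Prod.snd_swap] at hx ⊢
  rw [linearRemainder_splitEstimator] at hx
  by_contra! hcon
  have bound : ∀ {j : ℕ} {z : ℝ}, j ≤ n → |Real.sqrt j / Real.sqrt n * z| ≤ |z| := by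
    intro j z hj
    rw [abs_mul, abs_of_nonneg (by positivity)]
    refine mul_le_of_le_one_left (abs_nonneg _) (div_le_one_of_le₀ ?_ (Real.sqrt_nonneg _))
    exact Real.sqrt_le_sqrt (by exact_mod_cast hj)
  have := hx.trans ((abs_add_le _ _).trans
    (add_le_add (bound (hlam n)) (bound (Nat.sub_le n (lam n)))))
  linarith

end Sampling

/-! ### Pathwise differentiability in the full model -/

theorem tangentSpace₂_le_fullTangentSpace {𝒳 : Type*} [MeasurableSpace 𝒳] {H : Type*} {k : ℕ}
    {P : Eucl k → H → ProbabilityMeasure 𝒳} {𝒞 : Set (ℝ → H)} {θ : Eucl k} {G : H} :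
    tangentSpace₂ P 𝒞 θ G ≤ fullTangentSpace P 𝒞 θ G := by
  refine Submodule.topologicalClosure_mono (Submodule.span_mono ?_)
  rintro τ ⟨c, hc, hτ⟩
  exact ⟨0, c, hc, by simpa using hτ⟩

section FullModel

variable {𝒳 : Type*} [MeasurableSpace 𝒳]
  {H : Type*} [NormedAddCommGroup H] [InnerProductSpace ℝ H]
  {B : Type*} [NormedAddCommGroup B] [NormedSpace ℝ B] {k : ℕ}

theorem inner_rieszGradient {V : Type*} [NormedAddCommGroup V] [InnerProductSpace ℝ V]
    [CompleteSpace V] (D : V →L[ℝ] B) (b : StrongDual ℝ B) (v : V) :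
    inner ℝ (rieszGradient D b) v = b (D v) :=
  InnerProductSpace.toDual_symm_apply

theorem inner_infoOperator [CompleteSpace H] {𝒞 : Set (ℝ → H)} {Q : Measure 𝒳}
    (l : (Eucl k × tangentSpace 𝒞) →L[ℝ] Lp ℝ 2 Q) (h v : tangentSpace 𝒞) :
    inner ℝ (infoOperator l h) v = inner ℝ (score₂ l h) (score₂ l v) := by
  rw [infoOperator, ContinuousLinearMap.comp_apply, ContinuousLinearMap.adjoint_inner_left]

theorem apply_eq_sum_score₁_add_score₂ {𝒞 : Set (ℝ → H)} {Q : Measure 𝒳}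
    (l : (Eucl k × tangentSpace 𝒞) →L[ℝ] Lp ℝ 2 Q) (ζ : Eucl k) (h : tangentSpace 𝒞) :
    l (ζ, h) = ∑ j, ζ j • score₁ l j + score₂ l h := by
  have h1 : (ζ, h) = ∑ j, ζ j • ((EuclideanSpace.single j (1 : ℝ), 0) : Eucl k × tangentSpace 𝒞)
      + (0, h) := by
    refine Prod.ext ?_ ?_
    · simp only [Prod.fst_add, Prod.fst_sum, Prod.smul_fst, add_zero]
      ext i
      simp [Finset.sum_apply, Pi.single_apply]
    · simp [Prod.snd_sum]
  rw [h1, map_add, map_sum]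
  simp only [map_smul]
  rfl

variable {P : Eucl k → H → ProbabilityMeasure 𝒳} {𝒞 : Set (ℝ → H)} {θ : Eucl k} {G : H}
  {l : (Eucl k × tangentSpace 𝒞) →L[ℝ] Lp ℝ 2 (P θ G : Measure 𝒳)}

/-- By uniqueness of tangents, the generators of the full tangent space are all values of the score
operator. -/
theorem IsScoreOperator.exists_eq_of_isTangent (hl : IsScoreOperator P 𝒞 θ G l) {ζ : Eucl k}
    {c : ℝ → H} (hc : c ∈ 𝒞) {ρ : Lp ℝ 2 (P θ G : Measure 𝒳)}
    (hρ : IsTangent (P θ G) (fun η => P (θ + η • ζ) (c η)) ρ) :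
    ∃ h : tangentSpace 𝒞, (h : H) = deriv c 0 ∧ ρ = l (ζ, h) :=
  ⟨⟨deriv c 0, Submodule.le_topologicalClosure _ (Submodule.subset_span ⟨c, hc, rfl⟩)⟩, rfl,
    hρ.unique (hl.2 ζ c hc _ rfl)⟩

/-- If the tangents form a closed linear space, the scores for the infinite-dimensional parameter
belong to its tangent space. -/
theorem IsScoreOperator.score₂_mem (hl : IsScoreOperator P 𝒞 θ G l)
    (htan : tangentSet 𝒞 = (tangentSpace 𝒞 : Set H)) (h : tangentSpace 𝒞) :
    score₂ l h ∈ tangentSpace₂ P 𝒞 θ G := by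
  obtain ⟨c, hc, hch⟩ : (h : H) ∈ tangentSet 𝒞 := htan ▸ h.2
  refine Submodule.le_topologicalClosure _ (Submodule.subset_span ⟨c, hc, ?_⟩)
  simpa using! hl.2 0 c hc h hch.symm

/-- The `ζ` part is a combination of scores for `θ`, orthogonal to the submodel tangent space;
`htan` places `score₂ l h` in that space. -/
theorem inner_score₂_apply (hl : IsScoreOperator P 𝒞 θ G l)
    (htan : tangentSet 𝒞 = (tangentSpace 𝒞 : Set H))
    (horth : Submodule.span ℝ (Set.range (score₁ l)) ⟂ tangentSpace₂ P 𝒞 θ G)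
    (h h' : tangentSpace 𝒞) (ζ : Eucl k) :
    inner ℝ (score₂ l h) (l (ζ, h')) = inner ℝ (score₂ l h) (score₂ l h') := by
  rw [apply_eq_sum_score₁_add_score₂, inner_add_right, inner_sum, Finset.sum_eq_zero, zero_add]
  intro j _
  rw [real_inner_smul_right, real_inner_comm,
    Submodule.isOrtho_iff_inner_eq.1 horth _ (Submodule.subset_span ⟨j, rfl⟩) _
      (hl.score₂_mem htan h), mul_zero]

/-- In the adaptive case, a parameter whose gradients are in the range of the information operator
is pathwise differentiable in the full model, and its efficient influence functions are those of
the submodel. -/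
theorem exists_isFullPathwiseDeriv [CompleteSpace H] [CompleteSpace B] (hl : IsScoreOperator P 𝒞 θ G l)
    (htan : tangentSet 𝒞 = (tangentSpace 𝒞 : Set H)) {ν : H → B} {D : tangentSpace 𝒞 →L[ℝ] B}
    (hD : IsPathwiseDeriv 𝒞 G ν D)
    (hrange : ∀ b : StrongDual ℝ B, rieszGradient D b ∈ Set.range (infoOperator l))
    (horth : Submodule.span ℝ (Set.range (score₁ l)) ⟂ tangentSpace₂ P 𝒞 θ G) :
    ∃ Dfull : fullTangentSpace P 𝒞 θ G →L[ℝ] B, IsFullPathwiseDeriv P 𝒞 θ G ν Dfull ∧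
      ∀ (b : StrongDual ℝ B) (h : tangentSpace 𝒞), infoOperator l h = rieszGradient D b →
        score₂ l h = (rieszGradient Dfull b : fullTangentSpace P 𝒞 θ G) := by
  have hrep : ∀ (b : StrongDual ℝ B) (h : tangentSpace 𝒞), infoOperator l h = rieszGradient D b →
      ∀ v, b (D v) = inner ℝ (score₂ l h) (score₂ l v) := by
    intro b h hb v
    rw [← inner_infoOperator, hb, inner_rieszGradient]
  obtain ⟨E, hE, hE0⟩ := exists_factor_of_norm_le (score₂ l) D
    (exists_norm_le_of_forall_dual (score₂ l) D fun b => by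
      obtain ⟨h, hh⟩ := hrange b
      exact ⟨h, hrep b h hh⟩)
  have hEl : ∀ (ζ : Eucl k) (h : tangentSpace 𝒞), E (l (ζ, h)) = D h := by
    intro ζ h
    -- The difference is the score in direction `ζ`, orthogonal to the range of `score₂ l`.
    have : E (l (ζ, h) - score₂ l h) = 0 := hE0 _ fun v => by
      rw [inner_sub_left, real_inner_comm, inner_score₂_apply hl htan horth, real_inner_comm,
        sub_self]
    rw [map_sub, hE, sub_eq_zero] at this
    exact this
  refine ⟨E.comp (fullTangentSpace P 𝒞 θ G).subtypeL, ?_, ?_⟩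
  · intro ζ c hc ρ hρ
    obtain ⟨h, hh, he⟩ := hl.exists_eq_of_isTangent hc hρ
    have hDρ : E.comp (fullTangentSpace P 𝒞 θ G).subtypeL ρ = D h := by
      simp only [ContinuousLinearMap.comp_apply, Submodule.subtypeL_apply, he, hEl]
    rw [hDρ]
    exact hD c hc h hh
  · intro b h hb
    have hmem : score₂ l h ∈ fullTangentSpace P 𝒞 θ G :=
      tangentSpace₂_le_fullTangentSpace (hl.score₂_mem htan h)
    -- Both sides are linear and continuous in `w`, so agreement on tangents suffices.
    have hspan : ∀ w ∈ fullTangentSpace P 𝒞 θ G, b (E w) = inner ℝ (score₂ l h) w := by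
      have hclosed : IsClosed {w | b (E w) = inner ℝ (score₂ l h) w} :=
        isClosed_eq (by fun_prop) (by fun_prop)
      have hle : Submodule.span ℝ {ρ | ∃ ζ : Eucl k, ∃ c ∈ 𝒞,
          IsTangent (P θ G) (fun η => P (θ + η • ζ) (c η)) ρ} ≤
          LinearMap.eqLocus (b.comp E).toLinearMap
            (innerSL ℝ (score₂ l h)).toLinearMap := by
        refine Submodule.span_le.2 ?_
        rintro ρ ⟨ζ, c, hc, hρ⟩
        obtain ⟨h', -, rfl⟩ := hl.exists_eq_of_isTangent hc hρ
        change b (E (l (ζ, h'))) = inner ℝ (score₂ l h) (l (ζ, h'))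
        rw [hEl, inner_score₂_apply hl htan horth, hrep b h hb]
      exact fun w hw => closure_minimal (fun v hv => hle hv) hclosed hw
    have : (⟨score₂ l h, hmem⟩ : fullTangentSpace P 𝒞 θ G) =
        rieszGradient (E.comp (fullTangentSpace P 𝒞 θ G).subtypeL) b := by
      refine ext_inner_right ℝ fun w => ?_
      rw [inner_rieszGradient]
      exact (hspan w w.2).symm
    rw [← this]

end FullModel

end AdaptiveSplit

end

theorem corollary5p1
    {𝒳 : Type*} [MeasurableSpace 𝒳]
    {H : Type*} [NormedAddCommGroup H] [InnerProductSpace ℝ H] [CompleteSpace H]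
    {B : Type*} [NormedAddCommGroup B] [NormedSpace ℝ B] [CompleteSpace B]
    {k : ℕ}
    -- the semiparametric model, the point `(θ₀, G)`, the paths through `G`, and `B₀* ⊆ B*`
    (Θ : Set (Eucl k)) (hΘ : IsOpen Θ) (𝒢 : Set H) (P : Eucl k → H → ProbabilityMeasure 𝒳)
    (θ₀ : Eucl k) (hθ₀ : θ₀ ∈ Θ) (G : H) (hG : G ∈ 𝒢)
    (𝒞 : Set (ℝ → H)) (h𝒞 : IsPathCollection 𝒢 G 𝒞)
    (B₀ : Set (StrongDual ℝ B))
    -- regularity of the parametric submodel and Hellinger differentiability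
    (hreg : IsRegularParametricModel Θ (fun θ => P θ G))
    (l : (θ : Eucl k) → (Eucl k × tangentSpace 𝒞) →L[ℝ] Lp ℝ 2 (P θ G : Measure 𝒳))
    (hl : ∀ θ ∈ Θ, IsScoreOperator P 𝒞 θ G (l θ))
    -- (i) the tangents form a closed linear space
    (htan : tangentSet 𝒞 = (tangentSpace 𝒞 : Set H))
    -- (ii) pathwise differentiability of the parameter
    (ν : H → B) (D : tangentSpace 𝒞 →L[ℝ] B) (hD : IsPathwiseDeriv 𝒞 G ν D)
    -- (iii) nonsingular efficient information for `θ`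
    (hinfo : IsUnit (efficientInfo P 𝒞 θ₀ G (l θ₀)).det)
    -- the gradients are in the range of the information operator
    (hrange : ∀ b : StrongDual ℝ B, rieszGradient D b ∈ Set.range (infoOperator (l θ₀)))
    -- `ψ b θ` is a version of the submodel efficient influence function at `P_{θ,G}`
    (ψ : StrongDual ℝ B → Eucl k → 𝒳 → ℝ)
    (hψ : ∀ b ∈ B₀, ∀ᶠ θ in 𝓝 θ₀, IsSubmodelInfluence (l θ) (rieszGradient D b) (ψ b θ))
    -- smoothness of `ψ` in `θ`
    (hsmooth : ∀ b ∈ B₀, ∀ θ : ℕ → Eucl k, IsLocalSeq Θ θ₀ θ →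
      TendstoZeroInProb (P θ₀ G) (fun n x =>
        (Real.sqrt n)⁻¹ * ∑ i, ψ b (θ n) (x i) - (Real.sqrt n)⁻¹ * ∑ i, ψ b θ₀ (x i)))
    -- the submodel estimator, weakly locally submodel efficient
    (u : (n : ℕ) → (Fin n → 𝒳) → Eucl k → B)
    (hu_meas : ∀ b ∈ B₀, ∀ n, Measurable (fun p : (Fin n → 𝒳) × Eucl k => b (u n p.1 p.2)))
    (hu : ∀ b ∈ B₀, ∀ θ : ℕ → Eucl k, IsLocalSeq Θ θ₀ θ →
      TendstoZeroInProb (P θ₀ G) (fun n x =>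
        linearRemainder b (ν G) (u n x (θ n)) (ψ b (θ n)) x))
    -- the estimator of `θ`
    (t : (n : ℕ) → (Fin n → 𝒳) → Eucl k) (ht_meas : ∀ n, Measurable (t n))
    (ht : IsRootNConsistent (P θ₀ G) θ₀ t)
    -- orthogonality (adaptivity)
    (horth : Submodule.span ℝ (Set.range (score₁ (l θ₀))) ⟂ tangentSpace₂ P 𝒞 θ₀ G)
    -- the sample sizes of the split
    (lam : ℕ → ℕ) (hlam : ∀ n, lam n ≤ n)
    (hlam_inf : 0 < liminf (fun n : ℕ => (lam n : ℝ) / n) atTop)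
    (hlam_sup : limsup (fun n : ℕ => (lam n : ℝ) / n) atTop < 1) :
    -- in the full model, `ν` is pathwise differentiable with efficient influence functions `ψ`
    (∃ Dfull : fullTangentSpace P 𝒞 θ₀ G →L[ℝ] B,
      IsFullPathwiseDeriv P 𝒞 θ₀ G ν Dfull ∧
      ∀ b ∈ B₀, ψ b θ₀ =ᵐ[(P θ₀ G : Measure 𝒳)]
        (((rieszGradient Dfull b : fullTangentSpace P 𝒞 θ₀ G) : Lp ℝ 2 (P θ₀ G : Measure 𝒳)) : 𝒳 → ℝ)) ∧
    -- and the split-sample estimator is locally asymptotically linear in `ψ`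
    (∀ b ∈ B₀, ∀ θ : ℕ → Eucl k, IsLocalSeq Θ θ₀ θ →
      TendstoZeroInProb (P θ₀ G) (fun n x =>
        linearRemainder b (ν G) (splitEstimator u t (hlam n) x) (ψ b (θ n)) x)) := by
  refine ⟨?_, fun b hb θ hθ => ?_⟩
  · obtain ⟨Dfull, hDfull, hgrad⟩ :=
      exists_isFullPathwiseDeriv (hl θ₀ hθ₀) htan hD hrange horth
    refine ⟨Dfull, hDfull, fun b hb => ?_⟩
    obtain ⟨h, hh, hψh⟩ := (hψ b hb).self_of_nhds
    rwa [hgrad b h hh] at hψh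
  · obtain ⟨h, -, hψh⟩ := (hψ b hb).self_of_nhds
    -- Versions `ψ b θ` need not be measurable, let alone jointly in `θ`. The fixed `Lp`
    -- representative provides the measurability that Fubini requires.
    set f : 𝒳 → ℝ := ⇑(score₂ (l θ₀) h)
    have hf : Measurable f := (Lp.stronglyMeasurable (score₂ (l θ₀) h)).measurable
    have hshift : ∀ (n : ℕ) (û : B) (τ : Eucl k) (x : Fin n → 𝒳),
        (∀ i, ψ b θ₀ (x i) = f (x i)) →
        linearRemainder b (ν G) û f x = linearRemainder b (ν G) û (ψ b τ) x -
          -((Real.sqrt n)⁻¹ * ∑ i, ψ b τ (x i) - (Real.sqrt n)⁻¹ * ∑ i, ψ b θ₀ (x i)) := by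
      intro n û τ x hx
      have hn : Real.sqrt n * (n : ℝ)⁻¹ = (Real.sqrt n)⁻¹ := by
        rw [← div_eq_mul_inv, Real.sqrt_div_self]
      simp only [linearRemainder, hx, ← hn]
      ring
    have hsub : ∀ τ : ℕ → Eucl k, IsLocalSeq Θ θ₀ τ →
        TendstoZeroInProb (P θ₀ G) (fun n x => linearRemainder b (ν G) (u n x (τ n)) f x) := by
      intro τ hτ
      refine ((hu b hb τ hτ).sub (hsmooth b hb τ hτ).neg).congr_ae fun n => ?_
      filter_upwards [ae_pi_forall_eq hψh n] with x hx
      rw [hshift n _ (τ n) x hx]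
    refine ((tendsto_linearRemainder_splitEstimator hΘ hθ₀ hf (hu_meas b hb) hsub ht_meas ht hlam
      hlam_inf hlam_sup).sub (hsmooth b hb θ hθ)).congr_ae fun n => ?_
    filter_upwards [ae_pi_forall_eq hψh n] with x hx
    rw [hshift n _ (θ n) x hx]
    ring
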